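/- Let $n \ge 0$ and let $w = w_1 w_2 \cdots w_n \in S_n$ be a permutation of $\{1,\dots,n\}$ in one-line notation. Its number of ascents is $\operatorname{asc}(w) = \#\{i : 1 \le i \le n-1,\ w_i < w_{i+1}\}$. Let $S$ be a standard skew tableau with $m$ cells (English notation) whose row sizes weakly decrease from top to bottom. For $k \ge 1$ let $S^{(k)}$ be the standard skew tableau obtained by attaching $k-1$ shifted copies $S+m, S+2m, \dots, S+(k-1)m$ of $S$ to the right of $S$, row by row, where $S + x$ is $S$ with $x$ added to every entry. Let $\operatorname{Rect}$ denote rectification, i.e. the result of performing jeu de taquin inner slides until the shape is straight. We say that $S$ stabilizes at $k$ if every entry in $\{(k-1)m+1, \dots, km\}$ lies in the same row in $\operatorname{Rect}(S^{(k)})$ as in $S^{(k)}$, and we let $\operatorname{stab}(S)$ be the least $k \ge 1$ at which $S$ stabilizes. Let $T(w)$ be the standard skew tableau of shape $(n, n-1, \dots, 1)/(n-1, \dots, 1, 0)$, with one cell in each row and each column, whose entries read from bottom left to top right are $w_1, w_2, \dots, w_n$, and put $\operatorname{stab}(w) = \operatorname{stab}(T(w))$. Then, for every $n$ and every $w \in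 S_n$, the number $\operatorname{stab}(w)$ is well defined and $$\operatorname{stab}(w) > \operatorname{asc}(w).$$ -/

import Mathlib

/-- A semistandard skew tableau of shape `outer / inner`.  Rows and columns are numbered from `0`,
row `0` on top; `entry i j` is the entry in row `i` and column `j`, a positive integer on the cells
of the skew shape, and `0` (standing for "no entry") everywhere else. -/
@[ext]
structure SkewTableau where
  inner : YoungDiagram
  outer : YoungDiagram
  inner_le : inner ≤ outer
  entry : ℕ → ℕ → ℕ
  pos : ∀ {i j : ℕ}, (i, j) ∈ outer → (i, j) ∉ inner → 0 < entry i j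
  zeros : ∀ {i j : ℕ}, ¬ ((i, j) ∈ outer ∧ (i, j) ∉ inner) → entry i j = 0
  row_weak : ∀ {i j₁ j₂ : ℕ}, j₁ < j₂ → (i, j₁) ∉ inner → (i, j₂) ∈ outer →
    entry i j₁ ≤ entry i j₂
  col_strict : ∀ {i₁ i₂ j : ℕ}, i₁ < i₂ → (i₁, j) ∉ inner → (i₂, j) ∈ outer →
    entry i₁ j < entry i₂ j

namespace SkewTableau

/-- The cells of the skew shape. -/
def cells (S : SkewTableau) : Finset (ℕ × ℕ) := S.outer.cells \ S.inner.cells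

/-- The number of cells. -/
def size (S : SkewTableau) : ℕ := S.cells.card

/-- The number of cells in row `i`: the row vector of `S` is `rowSize S 0, rowSize S 1, …`. -/
def rowSize (S : SkewTableau) (i : ℕ) : ℕ := S.outer.rowLen i - S.inner.rowLen i

/-- `S` is standard: its entries are `1, …, |S|`, each used exactly once. -/
def IsStandard (S : SkewTableau) : Prop :=
  Set.BijOn (fun c : ℕ × ℕ => S.entry c.1 c.2) (S.cells : Set (ℕ × ℕ)) (Set.Icc 1 S.size)

/-- `S` has an entry `e ≥ 1` in row `i`. -/
def InRow (S : SkewTableau) (e i : ℕ) : Prop := ∃ j, S.entry i j = e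

/-! ### Jeu de taquin -/

/-- The cell whose entry slides into a hole at `c`: of the cells below and to the right of the hole
that belong to the tableau, the one with the smaller entry (the one below in case of a tie, which
cannot occur in a standard tableau); `none` if there is no such cell. -/
def nextHole (S : SkewTableau) (c : ℕ × ℕ) : Option (ℕ × ℕ) :=
  if (c.1 + 1, c.2) ∈ S.outer then
    if (c.1, c.2 + 1) ∈ S.outer ∧ S.entry c.1 (c.2 + 1) < S.entry (c.1 + 1) c.2 then
      some (c.1, c.2 + 1)
    else some (c.1 + 1, c.2)
  else if (c.1, c.2 + 1) ∈ S.outer then some (c.1, c.2 + 1)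
  else none

/-- `c` is a corner of the inner shape: it can be removed leaving a Young diagram. -/
def IsInnerCorner (S : SkewTableau) (c : ℕ × ℕ) : Prop :=
  c ∈ S.inner ∧ (c.1 + 1, c.2) ∉ S.inner ∧ (c.1, c.2 + 1) ∉ S.inner

/-- `S'` is obtained from `S` by an inner slide: a hole starts at a corner `c 0` of the inner shape,
moves along `c 0, c 1, …, c l` until nothing can slide into it, each entry met on the way
moving into the previous position of the hole, and the last position leaves the shape. -/
def InnerSlide (S S' : SkewTableau) : Prop :=
  ∃ (l : ℕ) (c : ℕ → ℕ × ℕ),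
    S.IsInnerCorner (c 0) ∧
    (∀ t < l, S.nextHole (c t) = some (c (t + 1))) ∧
    S.nextHole (c l) = none ∧
    S'.inner.cells = S.inner.cells.erase (c 0) ∧
    S'.outer.cells = S.outer.cells.erase (c l) ∧
    (∀ t < l, S'.entry (c t).1 (c t).2 = S.entry (c (t + 1)).1 (c (t + 1)).2) ∧
    (∀ i j, (∀ t ≤ l, c t ≠ (i, j)) → S'.entry i j = S.entry i j)

/-- `R` is the rectification of `S`: it has straight shape and arises from `S` by inner slides. -/
def IsRectification (S R : SkewTableau) : Prop :=
  Relation.ReflTransGen InnerSlide S R ∧ R.inner = ⊥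

/-! ### Attaching shifted copies -/

theorem inner_rowLen_le (S : SkewTableau) (i : ℕ) : S.inner.rowLen i ≤ S.outer.rowLen i := by
  by_contra! h
  have h1 := S.inner_le (YoungDiagram.mem_iff_lt_rowLen.2 h)
  exact absurd (YoungDiagram.mem_iff_lt_rowLen.1 h1) (lt_irrefl _)

theorem entry_mem (S : SkewTableau) (hS : S.IsStandard) {i j : ℕ} (h1 : S.inner.rowLen i ≤ j)
    (h2 : j < S.outer.rowLen i) : 1 ≤ S.entry i j ∧ S.entry i j ≤ S.size := by
  have h := hS.mapsTo (x := (i, j)) (by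
    simp [cells, YoungDiagram.mem_cells, YoungDiagram.mem_iff_lt_rowLen, h1, h2])
  simpa using h

/-- The outer shape of `S^(k)`: row `i` has `k` times as many cells to the right of the
inner shape as in `S`. -/
def repeatOuter (S : SkewTableau) (hr : Antitone S.rowSize) (k : ℕ) : YoungDiagram where
  cells := (Finset.range (S.outer.colLen 0)).biUnion fun i =>
    (Finset.range (S.inner.rowLen i + k * S.rowSize i)).image fun j => (i, j)
  isLowerSet := by
    rintro ⟨i, j⟩ ⟨i', j'⟩ ⟨hi, hj⟩ h
    simp only [Finset.coe_biUnion, Finset.coe_image, Set.mem_iUnion, Set.mem_image,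
      Finset.mem_coe, Finset.mem_range, Prod.mk.injEq] at h ⊢
    obtain ⟨a, ha, b, hb, rfl, rfl⟩ := h
    simp only at hi hj
    refine ⟨i', by omega, j', ?_, rfl, rfl⟩
    have h1 := S.inner.rowLen_anti i' a hi
    have h2 := Nat.mul_le_mul_left k (hr hi)
    omega

theorem mem_repeatOuter (S : SkewTableau) (hr : Antitone S.rowSize) (k i j : ℕ) :
    (i, j) ∈ S.repeatOuter hr k ↔ j < S.inner.rowLen i + k * S.rowSize i := by
  have h0 : S.outer.colLen 0 ≤ i → S.inner.rowLen i + k * S.rowSize i = 0 := by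
    intro h
    have h1 : S.outer.rowLen i = 0 := by
      by_contra h2
      have h3 : (i, 0) ∈ S.outer := YoungDiagram.mem_iff_lt_rowLen.2 (by omega)
      have := YoungDiagram.mem_iff_lt_colLen.1 h3
      omega
    have h2 := S.inner_rowLen_le i
    have h3 : S.rowSize i = 0 := by simp [rowSize, h1]
    rw [h3]; omega
  rw [← YoungDiagram.mem_cells]
  simp only [repeatOuter, Finset.mem_biUnion, Finset.mem_range, Finset.mem_image, Prod.mk.injEq]
  constructor
  · rintro ⟨a, _, b, hb, rfl, rfl⟩
    exact hb
  · intro h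
    refine ⟨i, ?_, j, h, rfl, rfl⟩
    by_contra h1
    have := h0 (by omega)
    omega

/-- The entries of `S^(k)`: the cell number `t` of row `i` (counted from `0`, from the inner shape
on) lies in copy number `t / rowSize i` of `S`, whose entries are shifted by `|S|` for every
preceding copy. -/
def repeatEntry (S : SkewTableau) (k i j : ℕ) : ℕ :=
  if S.inner.rowLen i ≤ j ∧ j < S.inner.rowLen i + k * S.rowSize i then
    S.entry i (S.inner.rowLen i + (j - S.inner.rowLen i) % S.rowSize i)
      + (j - S.inner.rowLen i) / S.rowSize i * S.size
  else 0

theorem repeatEntry_eq (S : SkewTableau) (hS : S.IsStandard) {k i j : ℕ}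
    (h1 : S.inner.rowLen i ≤ j) (h2 : j < S.inner.rowLen i + k * S.rowSize i) :
    ∃ q j', S.repeatEntry k i j = S.entry i j' + q * S.size ∧ S.inner.rowLen i ≤ j' ∧
      j' < S.outer.rowLen i ∧ j' + q * S.rowSize i = j ∧
      q = (j - S.inner.rowLen i) / S.rowSize i ∧ 1 ≤ S.entry i j' ∧ S.entry i j' ≤ S.size := by
  have hr : 0 < S.rowSize i := by
    rcases Nat.eq_zero_or_pos (S.rowSize i) with h | h
    · rw [h] at h2; omega
    · exact h
  have h3 := Nat.mod_lt (j - S.inner.rowLen i) hr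
  have h4 := Nat.mod_add_div' (j - S.inner.rowLen i) (S.rowSize i)
  have h5 : S.inner.rowLen i + (j - S.inner.rowLen i) % S.rowSize i < S.outer.rowLen i := by
    unfold rowSize at h3 hr ⊢
    omega
  refine ⟨(j - S.inner.rowLen i) / S.rowSize i,
    S.inner.rowLen i + (j - S.inner.rowLen i) % S.rowSize i, ?_, by omega, h5, by omega, rfl,
    S.entry_mem hS (by omega) h5⟩
  rw [repeatEntry, if_pos ⟨h1, h2⟩]

/-- `S^(k)`, for a standard skew tableau `S` whose row sizes weakly decrease from top to bottom:
the skew tableau obtained by attaching `k - 1` shifted copies of `S` to the right of `S`. -/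
def shiftedCopies (S : SkewTableau) (hS : S.IsStandard) (hr : Antitone S.rowSize) (k : ℕ) :
    SkewTableau where
  inner := S.inner
  outer := S.repeatOuter hr k
  inner_le := by
    rintro ⟨i, j⟩ h
    have := YoungDiagram.mem_iff_lt_rowLen.1 h
    exact (S.mem_repeatOuter hr k i j).2 (by omega)
  entry := S.repeatEntry k
  pos := by
    intro i j h1 h2
    rw [mem_repeatOuter] at h1
    rw [YoungDiagram.mem_iff_lt_rowLen, not_lt] at h2
    obtain ⟨q, a, h, _, _, _, _, h3, _⟩ := S.repeatEntry_eq hS h2 h1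
    omega
  zeros := by
    intro i j h
    rw [mem_repeatOuter, YoungDiagram.mem_iff_lt_rowLen] at h
    rw [repeatEntry, if_neg (by omega)]
  row_weak := by
    intro i j₁ j₂ hj h1 h2
    rw [mem_repeatOuter] at h2
    rw [YoungDiagram.mem_iff_lt_rowLen, not_lt] at h1
    obtain ⟨q, a, h, ha1, ha2, ha3, hq, he1, he2⟩ := S.repeatEntry_eq hS h1 (hj.trans h2)
    obtain ⟨p, b, h', hb1, hb2, hb3, hp, hf1, hf2⟩ := S.repeatEntry_eq hS (h1.trans hj.le) h2
    rw [h, h']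
    have hqp : q ≤ p := by rw [hq, hp]; exact Nat.div_le_div_right (by omega)
    rcases hqp.eq_or_lt with rfl | hlt
    · have := S.row_weak (i := i) (j₁ := a) (j₂ := b) (by omega)
        (by rw [YoungDiagram.mem_iff_lt_rowLen]; omega)
        (by rw [YoungDiagram.mem_iff_lt_rowLen]; omega)
      omega
    · have := Nat.mul_le_mul_right S.size (Nat.succ_le_of_lt hlt)
      rw [Nat.succ_mul] at this
      omega
  col_strict := by
    intro i₁ i₂ j hi h1 h2
    rw [mem_repeatOuter] at h2
    rw [YoungDiagram.mem_iff_lt_rowLen, not_lt] at h1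
    have hμ := S.inner.rowLen_anti i₁ i₂ hi.le
    have hrr := hr hi.le
    have hk := Nat.mul_le_mul_left k hrr
    obtain ⟨q, a, h, ha1, ha2, ha3, hq, he1, he2⟩ :=
      S.repeatEntry_eq hS (k := k) h1 (by omega)
    obtain ⟨p, b, h', hb1, hb2, hb3, hp, hf1, hf2⟩ := S.repeatEntry_eq hS (hμ.trans h1) h2
    rw [h, h']
    have hpos : 0 < S.rowSize i₂ := by unfold rowSize; omega
    have hqp : q ≤ p := by
      rw [hq, hp]
      exact (Nat.div_le_div_left hrr hpos).trans (Nat.div_le_div_right (by omega))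
    rcases hqp.eq_or_lt with rfl | hlt
    · have h3 := Nat.mul_le_mul_left q hrr
      have h4 := S.col_strict (j := a) hi
        (by rw [YoungDiagram.mem_iff_lt_rowLen]; omega)
        (by rw [YoungDiagram.mem_iff_lt_rowLen]; omega)
      have h5 : S.entry i₂ a ≤ S.entry i₂ b := by
        rcases (show a ≤ b by omega).eq_or_lt with rfl | hab
        · exact le_rfl
        · exact S.row_weak hab
            (by rw [YoungDiagram.mem_iff_lt_rowLen]; omega)
            (by rw [YoungDiagram.mem_iff_lt_rowLen]; omega)
      omega
    · have := Nat.mul_le_mul_right S.size (Nat.succ_le_of_lt hlt)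
      rw [Nat.succ_mul] at this
      omega

/-! ### Stabilization -/

/-- `S` stabilizes at `k`: the entries in `[(k - 1) m + 1, k m]`, where `m = |S|`, lie in the same
rows in the rectification of `S^(k)` and in `S^(k)`. -/
def StabilizesAt (S : SkewTableau) (hS : S.IsStandard) (hr : Antitone S.rowSize) (k : ℕ) : Prop :=
  ∃ R : SkewTableau, IsRectification (S.shiftedCopies hS hr k) R ∧
    ∀ e ∈ Finset.Icc ((k - 1) * S.size + 1) (k * S.size), ∀ i : ℕ,
      R.InRow e i ↔ (S.shiftedCopies hS hr k).InRow e i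

/-- The least positive integer at which `S` stabilizes. -/
noncomputable def stab (S : SkewTableau) (hS : S.IsStandard) (hr : Antitone S.rowSize) : ℕ :=
  sInf {k : ℕ | 1 ≤ k ∧ S.StabilizesAt hS hr k}

end SkewTableau

/-! ### Permutations -/

/-- The staircase `(n, n - 1, …, 1)`. -/
def staircase (n : ℕ) : YoungDiagram where
  cells := (Finset.range n ×ˢ Finset.range n).filter fun c => c.1 + c.2 < n
  isLowerSet := by
    rintro ⟨i, j⟩ ⟨i', j'⟩ ⟨hi, hj⟩ h
    simp at h hi hj ⊢
    omega

theorem mem_staircase {n i j : ℕ} : (i, j) ∈ staircase n ↔ i + j < n := by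
  rw [← YoungDiagram.mem_cells]
  simp [staircase]
  omega

theorem rowLen_staircase (n i : ℕ) : (staircase n).rowLen i = n - i := by
  apply le_antisymm
  · by_contra! h
    have := mem_staircase.1 (YoungDiagram.mem_iff_lt_rowLen.2 h)
    omega
  · by_contra! h
    have h1 : (i, (staircase n).rowLen i) ∈ staircase n := mem_staircase.2 (by omega)
    exact absurd (YoungDiagram.mem_iff_lt_rowLen.1 h1) (lt_irrefl _)

/-- For a permutation `w = w_1 … w_n`, written as the word of the numbers `w_{j+1} = w j + 1`, the
skew tableau `T(w)` of shape `(n, …, 2, 1) / (n - 1, …, 1, 0)`: one cell in each row and each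
column, the cells going from bottom left to top right, with `w_1, …, w_n` read in that order, that
is, with reading word `w`. -/
def permTableau {n : ℕ} (w : Equiv.Perm (Fin n)) : SkewTableau where
  inner := staircase (n - 1)
  outer := staircase n
  inner_le := by
    rintro ⟨i, j⟩ h
    have := mem_staircase.1 h
    exact mem_staircase.2 (by omega)
  entry i j := if h : i + j + 1 = n then (w ⟨j, by omega⟩ : ℕ) + 1 else 0
  pos := by
    intro i j h1 h2
    rw [mem_staircase] at h1 h2
    rw [dif_pos (by omega)]
    omega
  zeros := by
    intro i j h
    rw [mem_staircase, mem_staircase] at h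
    rw [dif_neg (by omega)]
  row_weak := by
    intro i j₁ j₂ h h1 h2
    rw [mem_staircase] at h1 h2
    omega
  col_strict := by
    intro i₁ i₂ j h h1 h2
    rw [mem_staircase] at h1 h2
    omega

theorem permTableau_mem_cells {n : ℕ} (w : Equiv.Perm (Fin n)) (c : ℕ × ℕ) :
    c ∈ (permTableau w).cells ↔ c.1 + c.2 + 1 = n := by
  obtain ⟨i, j⟩ := c
  simp only [SkewTableau.cells, Finset.mem_sdiff, YoungDiagram.mem_cells, permTableau,
    mem_staircase]
  omega

theorem permTableau_size {n : ℕ} (w : Equiv.Perm (Fin n)) : (permTableau w).size = n := by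
  have h : (permTableau w).cells = (Finset.range n).image fun j => (n - 1 - j, j) := by
    ext ⟨i, j⟩
    rw [permTableau_mem_cells]
    simp only [Finset.mem_image, Finset.mem_range, Prod.mk.injEq]
    constructor
    · intro h
      exact ⟨j, by omega, by omega, rfl⟩
    · rintro ⟨a, ha, h1, rfl⟩
      omega
  rw [SkewTableau.size, h, Finset.card_image_of_injective, Finset.card_range]
  intro a b hab
  exact (Prod.mk.inj hab).2

theorem permTableau_isStandard {n : ℕ} (w : Equiv.Perm (Fin n)) :
    (permTableau w).IsStandard := by
  rw [SkewTableau.IsStandard, permTableau_size]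
  refine ⟨?_, ?_, ?_⟩
  · rintro ⟨i, j⟩ h
    have h' := (permTableau_mem_cells w _).1 h
    simp only at h'
    simp only [permTableau, dif_pos h', Set.mem_Icc]
    omega
  · rintro ⟨i, j⟩ h ⟨i', j'⟩ h2 he
    have h' := (permTableau_mem_cells w _).1 h
    have h2' := (permTableau_mem_cells w _).1 h2
    simp only at h' h2'
    simp only [permTableau, dif_pos h', dif_pos h2'] at he
    have h3 := w.injective (Fin.ext (Nat.succ.inj he))
    simp only [Fin.mk.injEq] at h3
    ext <;> simp only <;> omega
  · rintro e ⟨h1, h2⟩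
    let a : Fin n := w.symm ⟨e - 1, by omega⟩
    have ha := a.2
    refine ⟨(n - 1 - a, a), (permTableau_mem_cells w _).2 (by simp only; omega), ?_⟩
    have h3 : n - 1 - (a : ℕ) + a + 1 = n := by omega
    simp only [permTableau, dif_pos h3, Fin.eta]
    simp only [a, Equiv.apply_symm_apply]
    omega

theorem permTableau_antitone {n : ℕ} (w : Equiv.Perm (Fin n)) :
    Antitone (permTableau w).rowSize := by
  intro i j h
  simp only [SkewTableau.rowSize, permTableau, rowLen_staircase]
  omega

/-- `stab(w) = stab(T(w))`. -/
noncomputable def permStab {n : ℕ} (w : Equiv.Perm (Fin n)) : ℕ :=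
  (permTableau w).stab (permTableau_isStandard w) (permTableau_antitone w)

/-- The number of ascents of `w`, i.e. of positions `i` such that `w_i < w_{i+1}`. -/
def ascents {n : ℕ} (w : Equiv.Perm (Fin n)) : ℕ :=
  (Finset.univ.filter fun i : Fin n => ∃ h : (i : ℕ) + 1 < n, w i < w ⟨(i : ℕ) + 1, h⟩).card

namespace SkewTableau

/-! ### The path of the hole in an inner slide -/

variable {S S' : SkewTableau} {l : ℕ} {c : ℕ → ℕ × ℕ}

/-! Lower bound. If `T(w)` stabilizes at `k`, some entry of the bottom row of the `k`-fold tableau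
stays in row `n - 1`, so the rectification has `n` rows and its first column is a transversal: one
entry per row, increasing downwards. Transversals pull back through inner slides
(`InnerSlide.hasTransversal`); this is the part of Greene's theorem that is needed, and it holds for
every sequence of slides, so confluence of rectification plays no role. Hence the `k`-fold tableau
itself has a transversal. Let its entry in the row of the `a`-th letter lie in copy `q a`, where `q
a < k`. Reading from bottom to top the entries decrease, so `q` weakly decreases, and it must drop
strictly at each ascent of `w`. Therefore `asc(w) ≤ q 0 < k` (`ascents_lt_of_hasTransversal`).

Existence. Far to the right, each row of the `k`-fold tableau is an arithmetic progression of
difference `n`. A slide preserves this from one column later on, because a hole that has entered the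
periodic zone runs right to the end of its row (`InnerSlide.periodicFrom`). The last entry of every
row is thus unchanged. For large `k` the periodic zone survives all the slides, and the `n` largest
entries are still the row ends (`PeriodicFrom.inRow_iff`), which is stabilization. -/

theorem nextHole_eq_some {p d : ℕ × ℕ} (h : S.nextHole p = some d) :
    (d = (p.1 + 1, p.2) ∧ (p.1 + 1, p.2) ∈ S.outer ∧
      ((p.1, p.2 + 1) ∈ S.outer → S.entry (p.1 + 1) p.2 ≤ S.entry p.1 (p.2 + 1))) ∨
    (d = (p.1, p.2 + 1) ∧ (p.1, p.2 + 1) ∈ S.outer ∧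
      ((p.1 + 1, p.2) ∈ S.outer → S.entry p.1 (p.2 + 1) < S.entry (p.1 + 1) p.2)) := by
  unfold nextHole at h
  split_ifs at h with h1 h2 h3
  · right
    exact ⟨(Option.some.inj h).symm, h2.1, fun _ => h2.2⟩
  · left
    exact ⟨(Option.some.inj h).symm, h1, fun h4 => not_lt.1 fun h5 => h2 ⟨h4, h5⟩⟩
  · right
    exact ⟨(Option.some.inj h).symm, h3, fun h4 => absurd h4 h1⟩

theorem nextHole_eq_none {p : ℕ × ℕ} (h : S.nextHole p = none) :
    (p.1 + 1, p.2) ∉ S.outer ∧ (p.1, p.2 + 1) ∉ S.outer := by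
  unfold nextHole at h
  split_ifs at h with h1 h2 h3
  exact ⟨h1, h3⟩

/-- The path of the hole in an inner slide, starting at an inner corner. -/
structure HolePath (S : SkewTableau) (l : ℕ) (c : ℕ → ℕ × ℕ) : Prop where
  corner : S.IsInnerCorner (c 0)
  step : ∀ t < l, S.nextHole (c t) = some (c (t + 1))
  halt : S.nextHole (c l) = none

namespace HolePath

theorem next_cases (P : HolePath S l c) {t : ℕ} (ht : t < l) :
    (c (t + 1) = ((c t).1 + 1, (c t).2) ∧ ((c t).1 + 1, (c t).2) ∈ S.outer ∧
      (((c t).1, (c t).2 + 1) ∈ S.outer →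
        S.entry ((c t).1 + 1) (c t).2 ≤ S.entry (c t).1 ((c t).2 + 1))) ∨
    (c (t + 1) = ((c t).1, (c t).2 + 1) ∧ ((c t).1, (c t).2 + 1) ∈ S.outer ∧
      (((c t).1 + 1, (c t).2) ∈ S.outer →
        S.entry (c t).1 ((c t).2 + 1) < S.entry ((c t).1 + 1) (c t).2)) :=
  nextHole_eq_some (P.step t ht)

theorem mono (P : HolePath S l c) {s t : ℕ} (hst : s ≤ t) (ht : t ≤ l) :
    (c s).1 ≤ (c t).1 ∧ (c s).2 ≤ (c t).2 := by
  induction t, hst using Nat.le_induction with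
  | base => exact ⟨le_rfl, le_rfl⟩
  | succ t hst ih =>
    have ih := ih (by omega)
    rcases P.next_cases (t := t) (by omega) with ⟨h, _⟩ | ⟨h, _⟩ <;> rw [h] <;> simp only <;> omega

theorem sum_eq (P : HolePath S l c) {t : ℕ} (ht : t ≤ l) :
    (c t).1 + (c t).2 = (c 0).1 + (c 0).2 + t := by
  induction t with
  | zero => rfl
  | succ t ih =>
    have ih := ih (by omega)
    rcases P.next_cases (t := t) (by omega) with ⟨h, _⟩ | ⟨h, _⟩ <;> rw [h] <;> simp only <;> omega

theorem injective (P : HolePath S l c) {s t : ℕ} (hs : s ≤ l) (ht : t ≤ l) (h : c s = c t) :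
    s = t := by
  have h1 := P.sum_eq hs
  have h2 := P.sum_eq ht
  rw [h] at h1
  omega

theorem mem_outer (P : HolePath S l c) {t : ℕ} (ht : t ≤ l) : c t ∈ S.outer := by
  cases t with
  | zero => exact S.inner_le P.corner.1
  | succ t =>
    rcases P.next_cases (t := t) (by omega) with ⟨h, h1, _⟩ | ⟨h, h1, _⟩ <;> rw [h] <;> exact h1

/-- The path stays weakly below and to the right of its start, so an inner cell here would force the
right neighbour of the starting corner into the inner shape. -/
theorem right_notMem_inner (P : HolePath S l c) {t : ℕ} (ht : t ≤ l) :
    ((c t).1, (c t).2 + 1) ∉ S.inner := fun h =>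
  P.corner.2.2 (S.inner.up_left_mem (P.mono (Nat.zero_le t) ht).1
    (Nat.succ_le_succ (P.mono (Nat.zero_le t) ht).2) h)

theorem below_notMem_inner (P : HolePath S l c) {t : ℕ} (ht : t ≤ l) :
    ((c t).1 + 1, (c t).2) ∉ S.inner := fun h =>
  P.corner.2.1 (S.inner.up_left_mem (Nat.succ_le_succ (P.mono (Nat.zero_le t) ht).1)
    (P.mono (Nat.zero_le t) ht).2 h)

theorem notMem_inner (P : HolePath S l c) {t : ℕ} (ht : t ≤ l) (h0 : t ≠ 0) :
    c t ∉ S.inner := by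
  obtain ⟨t, rfl⟩ := Nat.exists_eq_succ_of_ne_zero h0
  rcases P.next_cases (t := t) (by omega) with ⟨h, _⟩ | ⟨h, _⟩ <;> rw [Nat.succ_eq_add_one, h]
  · exact P.below_notMem_inner (by omega)
  · exact P.right_notMem_inner (by omega)

theorem col_le_of_down (P : HolePath S l c) {s t : ℕ} (ht : t < l) (hs : s ≤ l)
    (hd : c (t + 1) = ((c t).1 + 1, (c t).2)) (h : (c s).1 = (c t).1) : (c s).2 ≤ (c t).2 := by
  rcases le_or_gt s t with hst | hst
  · exact (P.mono hst ht.le).2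
  · have := (P.mono hst hs).1
    rw [Nat.succ_eq_add_one, hd] at this
    simp only at this
    omega

theorem row_le_of_right (P : HolePath S l c) {s t : ℕ} (ht : t < l) (hs : s ≤ l)
    (hd : c (t + 1) = ((c t).1, (c t).2 + 1)) (h : (c s).2 = (c t).2) : (c s).1 ≤ (c t).1 := by
  rcases le_or_gt s t with hst | hst
  · exact (P.mono hst ht.le).1
  · have := (P.mono hst hs).2
    rw [Nat.succ_eq_add_one, hd] at this
    simp only at this
    omega

end HolePath

/-- Every inner corner is the start of a hole path. -/
theorem IsInnerCorner.exists_holePath {p : ℕ × ℕ} (hp : S.IsInnerCorner p) :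
    ∃ l c, HolePath S l c ∧ c 0 = p := by
  -- The default `q` keeps the hole in place once it has halted, so that the iteration is total;
  -- only the positions up to the first halt are used.
  let c : ℕ → ℕ × ℕ := fun t => (fun q => (S.nextHole q).getD q)^[t] p
  have hc : ∀ t d, S.nextHole (c t) = some d → c (t + 1) = d := by
    intro t d h
    simp only [c, Function.iterate_succ_apply'] at h ⊢
    rw [h, Option.getD_some]
  have hex : ∃ t, S.nextHole (c t) = none := by
    by_contra! hne
    have hs : ∀ t, S.nextHole (c t) = some (c (t + 1)) := by
      intro t
      obtain ⟨d, hd⟩ := Option.ne_none_iff_exists'.1 (hne t)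
      rw [hc t d hd, hd]
    have hsum : ∀ t, t ≤ (c t).1 + (c t).2 := by
      intro t
      induction t with
      | zero => exact Nat.zero_le _
      | succ t ih =>
        rcases nextHole_eq_some (hs t) with ⟨h, _⟩ | ⟨h, _⟩ <;> rw [h] <;> simp only <;> omega
    -- Each step raises the coordinate sum by one, and this sum is bounded on the outer shape.
    obtain ⟨B, hB⟩ : ∃ B, B = S.outer.colLen 0 + S.outer.rowLen 0 := ⟨_, rfl⟩
    have hm : c (B + 1) ∈ S.outer := by
      rcases nextHole_eq_some (hs B) with ⟨h, h1, _⟩ | ⟨h, h1, _⟩ <;> rw [h] <;> exact h1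
    have h1 : (c (B + 1)).1 < S.outer.colLen 0 := YoungDiagram.mem_iff_lt_colLen.1
      (S.outer.up_left_mem le_rfl (Nat.zero_le _) hm)
    have h2 : (c (B + 1)).2 < S.outer.rowLen 0 := YoungDiagram.mem_iff_lt_rowLen.1
      (S.outer.up_left_mem (Nat.zero_le _) le_rfl hm)
    have h3 := hsum (B + 1)
    omega
  classical
  refine ⟨Nat.find hex, c, ⟨hp, fun t ht => ?_, Nat.find_spec hex⟩, rfl⟩
  obtain ⟨d, hd⟩ := Option.ne_none_iff_exists'.1 (Nat.find_min hex ht)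
  rw [hc t d hd, hd]

/-! ### The skew tableau produced by an inner slide -/

open Classical in
/-- The entries after the slide along a hole path. -/
def slideEntry (S : SkewTableau) (l : ℕ) (c : ℕ → ℕ × ℕ) (i j : ℕ) : ℕ :=
  if ∃ t ≤ l, c t = (i, j) then
    ((S.nextHole (i, j)).map fun d => S.entry d.1 d.2).getD 0
  else S.entry i j

namespace HolePath

theorem slideEntry_of_lt (P : HolePath S l c) {t : ℕ} (ht : t < l) :
    S.slideEntry l c (c t).1 (c t).2 = S.entry (c (t + 1)).1 (c (t + 1)).2 := by
  rw [slideEntry, if_pos ⟨t, ht.le, rfl⟩, Prod.mk.eta, P.step t ht]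
  rfl

theorem slideEntry_end (P : HolePath S l c) : S.slideEntry l c (c l).1 (c l).2 = 0 := by
  rw [slideEntry, if_pos ⟨l, le_rfl, rfl⟩, Prod.mk.eta, P.halt]
  rfl

theorem slideEntry_of_notMem {i j : ℕ} (h : ∀ t ≤ l, c t ≠ (i, j)) :
    S.slideEntry l c i j = S.entry i j :=
  if_neg fun ⟨t, ht, h1⟩ => h t ht h1

/-- The inner shape after the slide. -/
def inner (P : HolePath S l c) : YoungDiagram where
  cells := S.inner.cells.erase (c 0)
  isLowerSet := by
    rintro ⟨i, j⟩ ⟨i', j'⟩ ⟨hi, hj⟩ h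
    simp only [Finset.coe_erase, Set.mem_sdiff, Finset.mem_coe, YoungDiagram.mem_cells,
      Set.mem_singleton_iff] at h hi hj ⊢
    refine ⟨S.inner.up_left_mem hi hj h.1, fun h1 => ?_⟩
    have h2 := P.corner
    rw [← h1] at h2 h
    rcases hi.eq_or_lt with rfl | hi
    · rcases hj.eq_or_lt with rfl | hj
      · exact h.2 rfl
      · exact h2.2.2 (S.inner.up_left_mem le_rfl hj h.1)
    · exact h2.2.1 (S.inner.up_left_mem hi hj h.1)

/-- The outer shape after the slide. -/
def outer (P : HolePath S l c) : YoungDiagram where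
  cells := S.outer.cells.erase (c l)
  isLowerSet := by
    rintro ⟨i, j⟩ ⟨i', j'⟩ ⟨hi, hj⟩ h
    simp only [Finset.coe_erase, Set.mem_sdiff, Finset.mem_coe, YoungDiagram.mem_cells,
      Set.mem_singleton_iff] at h hi hj ⊢
    refine ⟨S.outer.up_left_mem hi hj h.1, fun h1 => ?_⟩
    have h2 := nextHole_eq_none P.halt
    rw [← h1] at h2 h
    rcases hi.eq_or_lt with rfl | hi
    · rcases hj.eq_or_lt with rfl | hj
      · exact h.2 rfl
      · exact h2.2 (S.outer.up_left_mem le_rfl hj h.1)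
    · exact h2.1 (S.outer.up_left_mem hi hj h.1)

theorem mem_inner_iff (P : HolePath S l c) {x : ℕ × ℕ} :
    x ∈ P.inner ↔ x ∈ S.inner ∧ x ≠ c 0 := by
  rw [← YoungDiagram.mem_cells, inner, Finset.mem_erase, YoungDiagram.mem_cells, and_comm]

theorem mem_outer_iff (P : HolePath S l c) {x : ℕ × ℕ} :
    x ∈ P.outer ↔ x ∈ S.outer ∧ x ≠ c l := by
  rw [← YoungDiagram.mem_cells, outer, Finset.mem_erase, YoungDiagram.mem_cells, and_comm]

/-- The entry that moves in comes from the right or from below, hence is no smaller. The start is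
excluded because it is an inner cell, where the order conditions of `S` say nothing. -/
theorem entry_le_slideEntry (P : HolePath S l c) {t : ℕ} (ht : t < l) (h0 : t ≠ 0) :
    S.entry (c t).1 (c t).2 ≤ S.slideEntry l c (c t).1 (c t).2 := by
  rw [P.slideEntry_of_lt ht]
  have h1 := P.notMem_inner ht.le h0
  rcases P.next_cases ht with ⟨h, h2, _⟩ | ⟨h, h2, _⟩ <;> rw [h]
  · exact (S.col_strict (Nat.lt_succ_self _) h1 h2).le
  · exact S.row_weak (Nat.lt_succ_self _) h1 h2

theorem slideEntry_row_weak (P : HolePath S l c) {i j₁ j₂ : ℕ} (hj : j₁ < j₂)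
    (h1 : (i, j₁) ∉ P.inner) (h2 : (i, j₂) ∈ P.outer) :
    S.slideEntry l c i j₁ ≤ S.slideEntry l c i j₂ := by
  rw [P.mem_outer_iff] at h2
  rw [P.mem_inner_iff] at h1
  have key : (i, j₁) ∉ S.inner → S.entry i j₂ ≤ S.slideEntry l c i j₂ := by
    intro h
    by_cases hb : ∃ t ≤ l, c t = (i, j₂)
    · obtain ⟨t, ht, hc⟩ := hb
      have htl : t ≠ l := fun h => h2.2 (h ▸ hc.symm)
      have h0 : t ≠ 0 := by
        rintro rfl
        have := P.corner.1
        rw [hc] at this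
        exact h (S.inner.up_left_mem le_rfl hj.le this)
      have := P.entry_le_slideEntry (by omega : t < l) h0
      rwa [hc] at this
    · push Not at hb
      rw [slideEntry_of_notMem hb]
  by_cases ha : ∃ t ≤ l, c t = (i, j₁)
  · obtain ⟨t, ht, hc⟩ := ha
    have hr : (i, j₁ + 1) ∈ S.outer := S.outer.up_left_mem le_rfl hj h2.1
    have htl : t < l := by
      refine lt_of_le_of_ne ht fun h => ?_
      have := (nextHole_eq_none P.halt).2
      rw [← h, hc] at this
      exact this hr
    have he := P.slideEntry_of_lt htl
    have hnr := P.right_notMem_inner ht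
    rw [hc] at he hnr
    simp only at he hnr
    rw [he]
    rcases P.next_cases htl with ⟨h, h3, h4⟩ | ⟨h, h3, h4⟩
    -- The hole leaves row `i` here, so cells further right in this row are off the path. It went
    -- down because the entry below is at most the one on the right.
    · rw [slideEntry_of_notMem (i := i) (j := j₂), h, hc]
      · rw [hc] at h4
        refine (h4 hr).trans ?_
        rcases (Nat.succ_le_of_lt hj).eq_or_lt with rfl | h5
        · exact le_rfl
        · exact S.row_weak h5 hnr h2.1
      · intro s hs hcs
        have := P.col_le_of_down htl hs h (by rw [hcs, hc])
        rw [hcs, hc] at this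
        simp only at this
        omega
    · rw [h, hc]
      have h5 : S.entry i (j₁ + 1) ≤ S.entry i j₂ := by
        rcases (Nat.succ_le_of_lt hj).eq_or_lt with rfl | h5
        · exact le_rfl
        · exact S.row_weak h5 hnr h2.1
      refine h5.trans ?_
      by_cases hb : ∃ t ≤ l, c t = (i, j₂)
      · obtain ⟨s, hs, hcs⟩ := hb
        have hsl : s ≠ l := fun h => h2.2 (h ▸ hcs.symm)
        have h0 : s ≠ 0 := by
          rintro rfl
          have := (P.mono (Nat.zero_le t) ht).2
          rw [hcs, hc] at this
          simp only at this
          omega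
        have := P.entry_le_slideEntry (by omega : s < l) h0
        rwa [hcs] at this
      · push Not at hb
        rw [slideEntry_of_notMem hb]
  · push Not at ha
    have h3 : (i, j₁) ∉ S.inner := fun h => h1 ⟨h, (ha 0 (Nat.zero_le _)).symm⟩
    rw [slideEntry_of_notMem ha]
    exact (S.row_weak hj h3 h2.1).trans (key h3)

theorem slideEntry_col_strict (P : HolePath S l c) {i₁ i₂ j : ℕ} (hi : i₁ < i₂)
    (h1 : (i₁, j) ∉ P.inner) (h2 : (i₂, j) ∈ P.outer) :
    S.slideEntry l c i₁ j < S.slideEntry l c i₂ j := by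
  rw [P.mem_outer_iff] at h2
  rw [P.mem_inner_iff] at h1
  have key : c 0 ≠ (i₂, j) → S.entry i₂ j ≤ S.slideEntry l c i₂ j := by
    intro h
    by_cases hb : ∃ t ≤ l, c t = (i₂, j)
    · obtain ⟨t, ht, hc⟩ := hb
      have htl : t ≠ l := fun h => h2.2 (h ▸ hc.symm)
      have h0 : t ≠ 0 := by
        rintro rfl
        exact h hc
      have := P.entry_le_slideEntry (by omega : t < l) h0
      rwa [hc] at this
    · push Not at hb
      rw [slideEntry_of_notMem hb]
  by_cases ha : ∃ t ≤ l, c t = (i₁, j)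
  · obtain ⟨t, ht, hc⟩ := ha
    have hr : (i₁ + 1, j) ∈ S.outer := S.outer.up_left_mem hi le_rfl h2.1
    have htl : t < l := by
      refine lt_of_le_of_ne ht fun h => ?_
      have := (nextHole_eq_none P.halt).1
      rw [← h, hc] at this
      exact this hr
    have he := P.slideEntry_of_lt htl
    have hnb := P.below_notMem_inner ht
    have h0 : c 0 ≠ (i₂, j) := by
      intro hcs
      have := (P.mono (Nat.zero_le t) ht).1
      rw [hcs, hc] at this
      simp only at this
      omega
    rw [hc] at he hnb
    simp only at he hnb
    rw [he]
    rcases P.next_cases htl with ⟨h, h3, h4⟩ | ⟨h, h3, h4⟩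
    · rw [hc] at h h4
      simp only at h h4
      rw [h]
      rcases (Nat.succ_le_of_lt hi).eq_or_lt with rfl | h5
      -- The lower cell is also on the path and is not its end, so it receives an entry as well. If
      -- that entry comes from the right, the two are compared through `(i₁, j + 1)`, which was not
      -- preferred at the previous step.
      · have htl' : t + 1 < l := by
          refine lt_of_le_of_ne htl fun h' => h2.2 ?_
          rw [← h', h]
        have he' := P.slideEntry_of_lt htl'
        rw [h] at he'
        simp only at he'
        rw [Nat.succ_eq_add_one, he']
        rcases P.next_cases htl' with ⟨h', h3', h4'⟩ | ⟨h', h3', h4'⟩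
        · rw [h'] at *
          rw [h] at *
          exact S.col_strict (Nat.lt_succ_self _) hnb h3'
        · rw [h', h]
          rw [h] at h3' h4'
          simp only at h3' h4' ⊢
          have h6 : (i₁, j + 1) ∈ S.outer := S.outer.up_left_mem (Nat.le_succ _) le_rfl h3'
          have h7 := P.right_notMem_inner ht
          rw [hc] at h7
          exact (h4 h6).trans_lt (S.col_strict (Nat.lt_succ_self _) h7 h3')
      · exact (S.col_strict h5 hnb h2.1).trans_le (key h0)
    · rw [slideEntry_of_notMem (i := i₂) (j := j), h, hc]
      · rw [hc] at h4
        refine (h4 hr).trans_le ?_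
        rcases (Nat.succ_le_of_lt hi).eq_or_lt with rfl | h5
        · exact le_rfl
        · exact (S.col_strict h5 hnb h2.1).le
      · intro s hs hcs
        have := P.row_le_of_right htl hs h (by rw [hcs, hc])
        rw [hcs, hc] at this
        simp only at this
        omega
  · push Not at ha
    have h3 : (i₁, j) ∉ S.inner := fun h => h1 ⟨h, (ha 0 (Nat.zero_le _)).symm⟩
    rw [slideEntry_of_notMem ha]
    refine (S.col_strict hi h3 h2.1).trans_le (key fun hc => h3 ?_)
    have := P.corner.1
    rw [hc] at this
    exact S.inner.up_left_mem hi.le le_rfl this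

/-- The tableau after the slide along a hole path. -/
def slide (P : HolePath S l c) : SkewTableau where
  inner := P.inner
  outer := P.outer
  inner_le := by
    intro x hx
    rw [P.mem_inner_iff] at hx
    rw [P.mem_outer_iff]
    refine ⟨S.inner_le hx.1, ?_⟩
    rintro rfl
    by_cases h0 : l = 0
    · subst h0
      exact hx.2 rfl
    · exact P.notMem_inner le_rfl h0 hx.1
  entry := S.slideEntry l c
  pos := by
    intro i j h1 h2
    rw [P.mem_outer_iff] at h1
    rw [P.mem_inner_iff] at h2
    by_cases ha : ∃ t ≤ l, c t = (i, j)
    · obtain ⟨t, ht, hc⟩ := ha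
      have htl : t < l := lt_of_le_of_ne ht fun h => h1.2 (h ▸ hc.symm)
      have he := P.slideEntry_of_lt htl
      rw [hc] at he
      rw [he]
      exact S.pos (P.mem_outer htl) (P.notMem_inner htl (Nat.succ_ne_zero _))
    · push Not at ha
      rw [slideEntry_of_notMem ha]
      exact S.pos h1.1 fun h => h2 ⟨h, (ha 0 (Nat.zero_le _)).symm⟩
  zeros := by
    intro i j h
    rw [P.mem_outer_iff, P.mem_inner_iff] at h
    by_cases hl : c l = (i, j)
    · have := P.slideEntry_end
      rwa [hl] at this
    · have h' : ¬ ((i, j) ∈ S.outer ∧ ((i, j) ∈ S.inner → (i, j) = c 0)) := by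
        intro h'
        exact h ⟨⟨h'.1, fun h'' => hl h''.symm⟩, fun h'' => h''.2 (h'.2 h''.1)⟩
      rw [slideEntry_of_notMem]
      · exact S.zeros fun h'' => h' ⟨h''.1, fun h3 => absurd h3 h''.2⟩
      · intro t ht hc
        refine h' ⟨hc ▸ P.mem_outer ht, fun h3 => ?_⟩
        by_cases h0 : t = 0
        · rw [← hc, h0]
        · exact absurd (hc ▸ h3) (P.notMem_inner ht h0)
  row_weak := P.slideEntry_row_weak
  col_strict := P.slideEntry_col_strict

theorem innerSlide (P : HolePath S l c) : InnerSlide S P.slide :=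
  ⟨l, c, P.corner, P.step, P.halt, rfl, rfl, fun _ ht => P.slideEntry_of_lt ht,
    fun _ _ h => slideEntry_of_notMem h⟩

end HolePath

theorem exists_isInnerCorner (h : S.inner ≠ ⊥) : ∃ p, S.IsInnerCorner p := by
  have hne : S.inner.cells.Nonempty := by
    rw [Finset.nonempty_iff_ne_empty]
    exact fun h' => h (YoungDiagram.ext (by rw [h']; rfl))
  obtain ⟨p, hp, hmax⟩ := S.inner.cells.exists_max_image (fun x => x.1 + x.2) hne
  refine ⟨p, (YoungDiagram.mem_cells _).1 hp, fun h' => ?_, fun h' => ?_⟩ <;>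
  · have := hmax _ ((YoungDiagram.mem_cells _).2 h')
    simp only at this
    omega

/-! ### Transversals -/

/-- A choice of one cell in each of the first `n` rows, with entries increasing downwards, i.e. a
decreasing subsequence of length `n` of the reading word. -/
def HasTransversal (S : SkewTableau) (n : ℕ) : Prop :=
  ∃ g : ℕ → ℕ, (∀ i < n, (i, g i) ∈ S.outer ∧ (i, g i) ∉ S.inner) ∧
    ∀ i, i + 1 < n → S.entry i (g i) < S.entry (i + 1) (g (i + 1))

theorem entry_mono_row {i j₁ j₂ : ℕ} (h : j₁ ≤ j₂) (h1 : (i, j₁) ∉ S.inner)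
    (h2 : (i, j₂) ∈ S.outer) : S.entry i j₁ ≤ S.entry i j₂ := by
  rcases h.eq_or_lt with rfl | h
  · exact le_rfl
  · exact S.row_weak h h1 h2

theorem hasTransversal_of_inner_eq_bot {n j : ℕ} (h : S.inner = ⊥) (hj : (n, j) ∈ S.outer) :
    S.HasTransversal (n + 1) := by
  have hn : ∀ x, x ∉ S.inner := by
    rw [h]; exact YoungDiagram.notMem_bot
  refine ⟨fun _ => 0, fun i hi => ⟨S.outer.up_left_mem (by omega) (Nat.zero_le _) hj, hn _⟩,
    fun i hi => S.col_strict (Nat.lt_succ_self _) (hn _)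
      (S.outer.up_left_mem (by omega) (Nat.zero_le _) hj)⟩

theorem InnerSlide.mem_outer (h : InnerSlide S S') {x : ℕ × ℕ} (hx : x ∈ S'.outer) :
    x ∈ S.outer := by
  obtain ⟨l, c, _, _, _, _, ho, _⟩ := h
  rw [← YoungDiagram.mem_cells, ho] at hx
  exact (YoungDiagram.mem_cells _).1 (Finset.mem_of_mem_erase hx)

/-- Undoing the slide keeps each chosen entry in its row unless the hole moved down from the chosen
cell, when the entry returns to the row below. In such a row the cell just right of the chosen one
is a substitute. -/
theorem InnerSlide.hasTransversal {n : ℕ} (h : InnerSlide S S')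
    (hn : ∀ i j, (i, j) ∈ S.outer → i < n) (hT : S'.HasTransversal n) : S.HasTransversal n := by
  classical
  have hsub := fun x => h.mem_outer (x := x)
  obtain ⟨l, c, h1, h2, h3, hin, hout, he, he'⟩ := h
  have P : HolePath S l c := ⟨h1, h2, h3⟩
  obtain ⟨g, hg, hlt⟩ := hT
  have hg1 : ∀ i < n, (i, g i) ∈ S.outer := fun i hi => hsub _ (hg i hi).1
  have hend : ∀ i < n, (i, g i) ≠ c l := by
    intro i hi h
    have := (hg i hi).1
    rw [← YoungDiagram.mem_cells, hout, h] at this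
    exact Finset.notMem_erase _ _ this
  have hg2 : ∀ i < n, (i, g i) ∈ S.inner → (i, g i) = c 0 := by
    intro i hi h
    by_contra hne
    refine (hg i hi).2 ?_
    rw [← YoungDiagram.mem_cells, hin]
    exact Finset.mem_erase.2 ⟨hne, h⟩
  -- the rows whose chosen entry comes from the row below
  let V : ℕ → Prop := fun i => ∃ t < l, c t = (i, g i) ∧ c (t + 1) = (i + 1, g i)
  let H : ℕ → Prop := fun i => ∃ t < l, c t = (i, g i) ∧ c (t + 1) = (i, g i + 1)
  -- The same column serves two purposes: in `H` rows it holds the old position of the chosen entry,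
  -- in `V` rows it holds the substitute.
  let f : ℕ → ℕ := fun i => if V i ∨ H i then g i + 1 else g i
  have hVmem : ∀ i, V i → (i + 1, g i) ∈ S.outer := by
    rintro i ⟨t, ht, -, h⟩
    rw [← h]; exact P.mem_outer ht
  have hVe : ∀ i, V i → S'.entry i (g i) = S.entry (i + 1) (g i) := by
    rintro i ⟨t, ht, ha, hb⟩
    have := he t ht
    rwa [ha, hb] at this
  have hVin : ∀ i, V i → (i, g i + 1) ∉ S.inner := by
    rintro i ⟨t, ht, ha, hb⟩
    have := P.right_notMem_inner ht.le
    rwa [ha] at this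
  have hVle : ∀ i, V i → (i, g i + 1) ∈ S.outer →
      S.entry (i + 1) (g i) ≤ S.entry i (g i + 1) := by
    rintro i ⟨t, ht, ha, hb⟩ hm
    rcases P.next_cases ht with ⟨h, _, h'⟩ | ⟨h, _⟩
    · rw [ha] at h'; exact h' hm
    · rw [hb, ha] at h; simp at h
  have hVg : ∀ i, V i → V (i + 1) → g i ≤ g (i + 1) := by
    rintro i ⟨t, ht, ha, hb⟩ ⟨s, hs, ha', hb'⟩
    have := P.col_le_of_down hs (s := t + 1) ht (by rw [hb', ha']) (by rw [ha', hb])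
    rwa [ha', hb] at this
  have hnV : ∀ i < n, ¬ V i → (i, f i) ∈ S.outer ∧ (i, f i) ∉ S.inner ∧
      S'.entry i (g i) = S.entry i (f i) := by
    intro i hi hv
    by_cases hh : H i
    · have hf : f i = g i + 1 := if_pos (Or.inr hh)
      obtain ⟨t, ht, ha, hb⟩ := hh
      rw [hf, ← hb]
      refine ⟨P.mem_outer ht, P.notMem_inner ht (Nat.succ_ne_zero _), ?_⟩
      have := he t ht
      rwa [ha, hb] at this
    · have hf : f i = g i := if_neg (not_or.2 ⟨hv, hh⟩)
      have hne : ∀ t ≤ l, c t ≠ (i, g i) := by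
        intro t ht hc
        have htl : t < l := lt_of_le_of_ne ht fun h => hend i hi (h ▸ hc.symm)
        rcases P.next_cases htl with ⟨h, _⟩ | ⟨h, _⟩ <;> rw [hc] at h
        · exact hv ⟨t, htl, hc, h⟩
        · exact hh ⟨t, htl, hc, h⟩
      rw [hf]
      exact ⟨hg1 i hi, fun h => hne 0 (Nat.zero_le _) (hg2 i hi h).symm, he' _ _ hne⟩
  have hfV : ∀ i, V i → f i = g i + 1 := fun i h => if_pos (Or.inl h)
  -- Downward induction on the row, with `m = n - i`: the substitute in row `i` exists because the
  -- pick in row `i + 1` lies strictly right of column `g i`.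
  have hVout : ∀ m i, n = i + m → V i → (i, f i) ∈ S.outer ∧
      S.entry i (f i) < S.entry (i + 1) (f (i + 1)) := by
    intro m
    induction m with
    | zero =>
      intro i hi hv
      have := hn _ _ (hVmem i hv)
      omega
    | succ m ih =>
      intro i hi hv
      have hi1 := hn _ _ (hVmem i hv)
      have key : (i + 1, g i + 1) ∈ S.outer ∧
          S.entry (i + 1) (g i + 1) ≤ S.entry (i + 1) (f (i + 1)) := by
        have hin1 : (i + 1, g i + 1) ∉ S.inner := fun h =>
          hVin i hv (S.inner.up_left_mem (Nat.le_succ _) le_rfl h)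
        by_cases hv1 : V (i + 1)
        · have h4 := (ih (i + 1) (by omega) hv1).1
          have h5 := hVg i hv hv1
          have h6 : g i + 1 ≤ f (i + 1) := by rw [hfV _ hv1]; omega
          exact ⟨S.outer.up_left_mem le_rfl h6 h4, entry_mono_row h6 hin1 h4⟩
        · obtain ⟨h4, h5, h6⟩ := hnV (i + 1) hi1 hv1
          have h7 := hlt i hi1
          rw [hVe i hv, h6] at h7
          -- The pick in row `i + 1` exceeds the entry at `(i + 1, g i)`, which the slide moved up,
          -- so it lies to the right of it.
          have h8 : g i + 1 ≤ f (i + 1) := by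
            by_contra! h8
            exact absurd (entry_mono_row (by omega) h5 (hVmem i hv)) (not_le.2 h7)
          exact ⟨S.outer.up_left_mem le_rfl h8 h4, entry_mono_row h8 hin1 h4⟩
      rw [hfV i hv]
      exact ⟨S.outer.up_left_mem (Nat.le_succ _) le_rfl key.1,
        (S.col_strict (Nat.lt_succ_self _) (hVin i hv) key.1).trans_le key.2⟩
  refine ⟨f, fun i hi => ?_, fun i hi => ?_⟩
  · by_cases hv : V i
    · refine ⟨(hVout (n - i) i (by omega) hv).1, ?_⟩
      rw [hfV i hv]
      exact hVin i hv
    · exact ⟨(hnV i hi hv).1, (hnV i hi hv).2.1⟩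
  · by_cases hv : V i
    · exact (hVout (n - i) i (by omega) hv).2
    · rw [← (hnV i (by omega) hv).2.2]
      by_cases hv1 : V (i + 1)
      · have h4 := (hVout (n - (i + 1)) (i + 1) (by omega) hv1).1
        have h5 := hlt i hi
        rw [hVe _ hv1] at h5
        rw [hfV _ hv1] at h4 ⊢
        -- The substitute is at least the entry it replaces, because the hole moved down rather than
        -- right.
        exact h5.trans_le (hVle _ hv1 h4)
      · rw [← (hnV (i + 1) hi hv1).2.2]
        exact hlt i hi

theorem hasTransversal_of_slides {n : ℕ} (h : Relation.ReflTransGen InnerSlide S S')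
    (hn : ∀ i j, (i, j) ∈ S.outer → i < n) (hT : S'.HasTransversal n) : S.HasTransversal n := by
  induction h using Relation.ReflTransGen.head_induction_on with
  | refl => exact hT
  | head h _ ih => exact h.hasTransversal hn (ih fun i j hij => hn i j (h.mem_outer hij))

/-! ### Tableaux that are periodic to the right -/

/-- `S` has `n` rows, all of length at least `M`, and from column `C` on the entries of row `i`
form an arithmetic progression of difference `n` that ends in `(k - 1) * n + v i`. -/
def PeriodicFrom (S : SkewTableau) (n k : ℕ) (v : ℕ → ℕ) (C M : ℕ) : Prop :=
  ∃ L : ℕ → ℕ, (∀ i j, (i, j) ∈ S.outer ↔ i < n ∧ j < L i) ∧ (∀ i < n, M ≤ L i) ∧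
    ∀ i < n, ∀ j, C ≤ j → j < L i → S.entry i j + L i * n = (k + j) * n + v i

theorem HolePath.exists_col_eq (P : HolePath S l c) {j : ℕ} (h0 : (c 0).2 ≤ j)
    (h1 : j ≤ (c l).2) : ∃ t ≤ l, (c t).2 = j := by
  have key : ∀ t ≤ l, j ≤ (c t).2 → ∃ s ≤ t, (c s).2 = j := by
    intro t
    induction t with
    | zero => exact fun _ h => ⟨0, le_rfl, le_antisymm h0 h⟩
    | succ t ih =>
      intro ht h
      by_cases hj : j ≤ (c t).2
      · obtain ⟨s, hs, hc⟩ := ih (by omega) hj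
        exact ⟨s, by omega, hc⟩
      · refine ⟨t + 1, le_rfl, ?_⟩
        rcases P.next_cases ht with ⟨h', _⟩ | ⟨h', _⟩ <;> rw [h'] at h ⊢ <;> simp only at h ⊢ <;>
          omega
  exact key l le_rfl h1

/-- Whether the hole prefers right to down is the same question in every column of the periodic
zone, since adjacent rows have the same difference `n`. So beyond column `C` it never turns down:
one row is shifted left by one cell and shortened by one, and all others are unchanged there. The
formula anchored at the row end survives this. -/
theorem InnerSlide.periodicFrom {n k C M : ℕ} {v : ℕ → ℕ} (h : InnerSlide S S')
    (hv : ∀ i < n, 0 < v i ∧ v i ≤ n) (hC : ∀ i j, (i, j) ∈ S.inner → j ≤ C) (hM : C + 2 ≤ M)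
    (hS : S.PeriodicFrom n k v C M) : S'.PeriodicFrom n k v (C + 1) (M - 1) := by
  obtain ⟨l, c, h1, h2, h3, hin, hout, he, he'⟩ := h
  have P : HolePath S l c := ⟨h1, h2, h3⟩
  obtain ⟨L, hL, hLM, hp⟩ := hS
  have hc0 : (c 0).2 ≤ C := hC _ _ P.corner.1
  -- rows in which the hole moves right for ever
  let R : ℕ → Prop := fun i => ∀ j, C ≤ j → (i + 1, j) ∈ S.outer →
    (i, j + 1) ∈ S.outer ∧ S.entry i (j + 1) < S.entry (i + 1) j
  have hR : ∀ t ≤ l, C < (c t).2 → R (c t).1 := by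
    intro t
    induction t with
    | zero => intro _ h; omega
    | succ t ih =>
      intro ht h
      rcases P.next_cases ht with ⟨h', h4, h5⟩ | ⟨h', h4, h5⟩
      · rw [h'] at h
        have hR := ih (by omega) h _ h.le h4
        exact absurd hR.2 (not_lt.2 (h5 hR.1))
      · rw [h'] at h ⊢
        by_cases hlt : C < (c t).2
        · exact ih (by omega) hlt
        · simp only at h ⊢
          have hc : (c t).2 = C := by omega
          generalize (c t).1 = i at *
          rw [hc] at h4 h5
          intro j hj hm
          obtain ⟨hi, hjL⟩ := (hL _ _).1 hm
          obtain ⟨hi', hCL⟩ := (hL _ _).1 h4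
          have h6 := h5 ((hL _ _).2 ⟨hi, by omega⟩)
          have e1 := hp i hi' (C + 1) (by omega) hCL
          have e2 := hp (i + 1) hi C le_rfl (by omega)
          have e3 := hp (i + 1) hi j hj hjL
          have v1 := hv i hi'
          have v2 := hv (i + 1) hi
          simp only [add_mul, one_mul] at e1 e2 e3
          -- As `v` takes values in `[1, n]`, the single comparison at column `C` makes row `i`
          -- strictly longer than row `i + 1`, so row `i` still has a right neighbour whenever row
          -- `i + 1` has a cell below the hole.
          have h7 : L (i + 1) * n < L i * n := by omega
          have h8 := Nat.lt_of_mul_lt_mul_right h7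
          have e4 := hp i hi' (j + 1) (by omega) (by omega)
          simp only [add_mul, one_mul] at e4
          exact ⟨(hL _ _).2 ⟨hi', by omega⟩, by omega⟩
  have hstep : ∀ t < l, C < (c t).2 → c (t + 1) = ((c t).1, (c t).2 + 1) := by
    intro t ht h
    rcases P.next_cases ht with ⟨h', h4, h5⟩ | ⟨h', _⟩
    · have := hR t ht.le h _ h.le h4
      exact absurd this.2 (not_lt.2 (h5 this.1))
    · exact h'
  obtain ⟨hr, hrL⟩ := (hL (c l).1 (c l).2).1 (P.mem_outer le_rfl)
  have hend : (c l).2 + 1 = L (c l).1 := by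
    have := (nextHole_eq_none P.halt).2
    rw [hL] at this
    omega
  have hrow : ∀ m t, t + m = l → C < (c t).2 → (c t).1 = (c l).1 := by
    intro m
    induction m with
    | zero => intro t ht _; rw [← ht]; rfl
    | succ m ih =>
      intro t ht h
      have h4 := hstep t (by omega) h
      have h5 := ih (t + 1) (by omega) (by rw [h4]; simp only; omega)
      rwa [h4] at h5
  have hLr := hLM _ hr
  refine ⟨Function.update L (c l).1 (c l).2, fun i j => ?_, fun i hi => ?_, fun i hi j hj hjL => ?_⟩
  · rw [← YoungDiagram.mem_cells, hout, Finset.mem_erase, YoungDiagram.mem_cells, hL]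
    rcases eq_or_ne i (c l).1 with rfl | hne
    · rw [Function.update_self, ← hend, Ne, Prod.ext_iff]
      simp only [true_and]
      omega
    · rw [Function.update_of_ne hne, Ne, Prod.ext_iff]
      simp only [hne, false_and, not_false_eq_true, true_and]
  · rcases eq_or_ne i (c l).1 with rfl | hne
    · rw [Function.update_self]; omega
    · rw [Function.update_of_ne hne]; have := hLM i hi; omega
  · rcases eq_or_ne i (c l).1 with rfl | hne
    · rw [Function.update_self] at hjL ⊢
      obtain ⟨t, ht, hc⟩ := P.exists_col_eq (j := j) (by omega) hjL.le
      have hct : c t = ((c l).1, j) := Prod.ext (hrow (l - t) t (by omega) (by omega)) hc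
      have htl : t < l := lt_of_le_of_ne ht fun h => by rw [← h, hc] at hjL; omega
      have h4 := hstep t htl (by omega)
      have h5 := he t htl
      rw [h4, hct] at h5
      have h6 := hp _ hr (j + 1) (by omega) (by omega)
      rw [h5]
      rw [← hend] at h6
      simp only [add_mul, one_mul] at h6 ⊢
      omega
    · rw [Function.update_of_ne hne] at hjL ⊢
      rw [he' i j fun t ht hc => hne ?_]
      · exact hp i hi j (by omega) hjL
      · have := hrow (l - t) t (by omega) (by rw [hc]; exact hj)
        rwa [hc] at this

/-- A periodic tableau with long rows has a periodic rectification. -/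
theorem exists_isRectification {n k : ℕ} {v : ℕ → ℕ} (hv : ∀ i < n, 0 < v i ∧ v i ≤ n) (m : ℕ) :
    ∀ (S : SkewTableau) (C M : ℕ), S.inner.cells.card = m → (∀ i j, (i, j) ∈ S.inner → j ≤ C) →
      C + 2 * m + 1 ≤ M → S.PeriodicFrom n k v C M →
      ∃ R, IsRectification S R ∧ R.PeriodicFrom n k v (C + m) (M - m) := by
  induction m with
  | zero =>
    intro S C M h0 _ _ hS
    refine ⟨S, ⟨Relation.ReflTransGen.refl, YoungDiagram.ext ?_⟩, hS⟩
    rw [Finset.card_eq_zero.1 h0]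
    rfl
  | succ m ih =>
    intro S C M hm hC hM hS
    have hne : S.inner ≠ ⊥ := by
      intro h
      rw [h] at hm
      simp at hm
    obtain ⟨p, hp⟩ := exists_isInnerCorner hne
    obtain ⟨l, c, P, rfl⟩ := hp.exists_holePath
    have hcard : P.slide.inner.cells.card = m := by
      have : P.slide.inner.cells = S.inner.cells.erase (c 0) := rfl
      rw [this, Finset.card_erase_of_mem ((YoungDiagram.mem_cells _).2 P.corner.1), hm]
      rfl
    -- Each slide costs one column on the left of the periodic zone and one at the row ends, hence
    -- the `2 * m` in the bound on `M`.
    obtain ⟨R, hR, hR'⟩ := ih P.slide (C + 1) (M - 1) hcard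
      (fun i j h => (hC i j (P.mem_inner_iff.1 h).1).trans (Nat.le_succ _)) (by omega)
      (P.innerSlide.periodicFrom hv hC (by omega) hS)
    refine ⟨R, ⟨Relation.ReflTransGen.head P.innerSlide hR.1, hR.2⟩, ?_⟩
    rwa [show C + (m + 1) = C + 1 + m by omega, show M - (m + 1) = M - 1 - m by omega]

/-- In a periodic tableau the greatest `n` possible entries are at the ends of their rows. -/
theorem PeriodicFrom.inRow_iff {n k C M : ℕ} {v : ℕ → ℕ} (hv : ∀ i < n, 0 < v i ∧ v i ≤ n)
    (hM : C + 1 < M) (hS : S.PeriodicFrom n k v C M)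
    {e i : ℕ} (h1 : (k - 1) * n + 1 ≤ e) (h2 : e ≤ k * n) :
    S.InRow e i ↔ i < n ∧ e = (k - 1) * n + v i := by
  obtain ⟨L, hL, hLM, hp⟩ := hS
  have hk : 0 < k := by
    rcases Nat.eq_zero_or_pos k with rfl | hk
    · omega
    · exact hk
  obtain ⟨k, rfl⟩ := Nat.exists_eq_succ_of_ne_zero hk.ne'
  simp only [Nat.succ_eq_add_one, Nat.add_sub_cancel, add_mul, one_mul] at h1 h2 hp ⊢
  constructor
  · rintro ⟨j, rfl⟩
    have hm : (i, j) ∈ S.outer := by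
      by_contra h
      have := S.zeros (i := i) (j := j) fun h' => h h'.1
      omega
    obtain ⟨hi, hj⟩ := (hL _ _).1 hm
    refine ⟨hi, ?_⟩
    have hvi := hv i hi
    have hLi := hLM i hi
    by_cases hjC : C ≤ j
    · have h3 := hp i hi j hjC hj
      by_contra hne
      have h4 : j + 1 < L i := by
        refine lt_of_le_of_ne hj fun h => hne ?_
        rw [← h] at h3
        simp only [add_mul, one_mul] at h3
        omega
      have h5 := Nat.mul_le_mul_right n (Nat.succ_le_of_lt h4)
      simp only [Nat.succ_eq_add_one, add_mul, one_mul] at h5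
      omega
    · have hin : (i, j) ∉ S.inner := by
        intro h
        have := S.zeros (i := i) (j := j) fun h' => h'.2 h
        omega
      -- Since `C + 1 < L i`, column `C` is not the last of its row; its entry is at most `(k - 1) *
      -- n` in the original numbering of copies, and so is everything left of it.
      have h3 := hp i hi C le_rfl (by omega)
      have h4 := S.row_weak (not_le.1 hjC) hin ((hL i C).2 ⟨hi, by omega⟩)
      have h5 := Nat.mul_le_mul_right n (show C + 1 + 1 ≤ L i by omega)
      simp only [add_mul, one_mul] at h5
      omega
  · rintro ⟨hi, rfl⟩
    have hLi := hLM i hi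
    refine ⟨L i - 1, ?_⟩
    have h3 := hp i hi (L i - 1) (by omega) (by omega)
    have h4 : L i * n = (L i - 1 + 1) * n := by rw [Nat.sub_add_cancel (by omega)]
    rw [h4] at h3
    simp only [add_mul, one_mul] at h3
    omega

end SkewTableau

/-! ### Permutations -/

section Permutation

open SkewTableau

variable {n : ℕ} (w : Equiv.Perm (Fin n))

/-- The tableau of `k` shifted copies of `T(w)`. -/
noncomputable def permCopies (k : ℕ) : SkewTableau :=
  (permTableau w).shiftedCopies (permTableau_isStandard w) (permTableau_antitone w) k

/-- The entry of `T(w)` in row `i`. -/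
def rowValue (i : ℕ) : ℕ := (permTableau w).entry i (n - 1 - i)

theorem rowValue_eq (a : Fin n) : rowValue w (n - 1 - a) = w a + 1 := by
  have h1 : n - 1 - (n - 1 - (a : ℕ)) = a := by omega
  have h2 : n - 1 - (a : ℕ) + a + 1 = n := by omega
  simp only [rowValue, permTableau, h1, dif_pos h2, Fin.eta]

theorem rowValue_bounds (i : ℕ) (hi : i < n) : 0 < rowValue w i ∧ rowValue w i ≤ n := by
  have h := rowValue_eq w ⟨n - 1 - i, by omega⟩
  rw [show n - 1 - (n - 1 - i) = i by omega] at h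
  omega

theorem rowSize_permTableau {i : ℕ} (hi : i < n) : (permTableau w).rowSize i = 1 := by
  simp only [rowSize, permTableau, rowLen_staircase]
  omega

theorem mem_permCopies_outer {k i j : ℕ} :
    (i, j) ∈ (permCopies w k).outer ↔ i < n ∧ j < n - 1 - i + k := by
  refine ((permTableau w).mem_repeatOuter (permTableau_antitone w) k i j).trans ?_
  by_cases hi : i < n
  · rw [rowSize_permTableau w hi]
    simp only [permTableau, rowLen_staircase]
    omega
  · simp only [rowSize, permTableau, rowLen_staircase]
    have h1 : n - 1 - i = 0 := by omega
    have h2 : n - i = 0 := by omega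
    simp [h1, h2, hi]

theorem mem_permCopies_inner {k i j : ℕ} :
    (i, j) ∈ (permCopies w k).inner ↔ i + j < n - 1 := mem_staircase

theorem permCopies_entry {k i j : ℕ} (hi : i < n) (h1 : n - 1 - i ≤ j)
    (h2 : j < n - 1 - i + k) :
    (permCopies w k).entry i j = rowValue w i + (j - (n - 1 - i)) * n := by
  have h0 : (permTableau w).inner.rowLen i = n - 1 - i := rowLen_staircase _ _
  change (permTableau w).repeatEntry k i j = _
  rw [repeatEntry, h0, rowSize_permTableau w hi, permTableau_size, if_pos (by omega), Nat.mod_one,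
    Nat.div_one]
  rfl

theorem permCopies_periodicFrom (k : ℕ) :
    (permCopies w k).PeriodicFrom n k (rowValue w) n k := by
  refine ⟨fun i => n - 1 - i + k, fun i j => mem_permCopies_outer w, fun i _ => Nat.le_add_left _ _,
    fun i hi j hj hjL => ?_⟩
  rw [permCopies_entry w hi (by omega) hjL]
  obtain ⟨d, rfl⟩ := Nat.exists_eq_add_of_le (show n - 1 - i ≤ j by omega)
  rw [Nat.add_sub_cancel_left]
  ring

/-! ### Stabilization occurs -/

theorem exists_stabilizesAt :
    ∃ k, 1 ≤ k ∧ (permTableau w).StabilizesAt (permTableau_isStandard w)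
      (permTableau_antitone w) k := by
  let N := (staircase (n - 1)).cells.card
  -- After `N` slides, one per inner cell, the zone starts at column `n + N` while rows have length
  -- at least `k - N = n + N + 2`, just enough for `PeriodicFrom.inRow_iff`.
  let k := n + 2 * N + 2
  have hk : k = n + 2 * N + 2 := rfl
  have hC : ∀ i j, (i, j) ∈ (permCopies w k).inner → j ≤ n := by
    intro i j h
    rw [mem_permCopies_inner] at h
    omega
  obtain ⟨R, hR, hRp⟩ := exists_isRectification (rowValue_bounds w) N (permCopies w k) n k rfl
    hC (by omega) (permCopies_periodicFrom w k)
  refine ⟨k, by omega, R, hR, fun e he i => ?_⟩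
  rw [permTableau_size, Finset.mem_Icc] at he
  rw [hRp.inRow_iff (rowValue_bounds w) (by omega) he.1 he.2]
  exact ((permCopies_periodicFrom w k).inRow_iff (rowValue_bounds w) (by omega) he.1 he.2).symm

/-! ### Transversals and ascents -/

theorem ascents_lt_of_hasTransversal {k : ℕ} (hn : 0 < n)
    (h : (permCopies w k).HasTransversal n) : ascents w < k := by
  obtain ⟨g, hg, hlt⟩ := h
  have hg' : ∀ i < n, n - 1 - i ≤ g i ∧ g i < n - 1 - i + k := by
    intro i hi
    have := hg i hi
    rw [mem_permCopies_outer, mem_permCopies_inner] at this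
    omega
  -- the number of the copy that contains the chosen cell in the row of the `a`-th letter
  let q : ℕ → ℕ := fun a => g (n - 1 - a) - a
  have hqk : ∀ a < n, q a < k := by
    intro a ha
    have := hg' (n - 1 - a) (by omega)
    simp only [q]
    omega
  have hqlt : ∀ a, a + 1 < n → rowValue w (n - 1 - (a + 1)) + q (a + 1) * n <
      rowValue w (n - 1 - a) + q a * n := by
    intro a ha
    have h1 := hlt (n - 1 - (a + 1)) (by omega)
    have h2 := hg' (n - 1 - (a + 1)) (by omega)
    have h3 := hg' (n - 1 - a) (by omega)
    rw [show n - 1 - (a + 1) + 1 = n - 1 - a by omega, permCopies_entry w (by omega) h2.1 h2.2,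
      permCopies_entry w (by omega) h3.1 h3.2, show n - 1 - (n - 1 - (a + 1)) = a + 1 by omega,
      show n - 1 - (n - 1 - a) = a by omega] at h1
    exact h1
  -- Row values lie in `[1, n]`, so an entry in a later copy is always larger.
  have hq : ∀ a, a + 1 < n → q (a + 1) ≤ q a := by
    intro a ha
    have h1 := hqlt a ha
    have h2 := rowValue_bounds w (n - 1 - (a + 1)) (by omega)
    have h3 := rowValue_bounds w (n - 1 - a) (by omega)
    by_contra! h4
    have h5 := Nat.mul_le_mul_right n (Nat.succ_le_of_lt h4)
    rw [Nat.succ_mul] at h5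
    omega
  have hqa : ∀ a b, a ≤ b → b < n → q b ≤ q a := by
    intro a b hab
    induction b, hab using Nat.le_induction with
    | base => exact fun _ => le_rfl
    | succ b _ ih => exact fun hb => (hq b hb).trans (ih (by omega))
  have hasc : ∀ (a : Fin n) (h : (a : ℕ) + 1 < n), w a < w ⟨a + 1, h⟩ → q (a + 1) < q a := by
    intro a h hw
    have h1 := hqlt a h
    rw [rowValue_eq w a, rowValue_eq w ⟨a + 1, h⟩] at h1
    refine lt_of_le_of_ne (hq a h) fun h2 => ?_
    rw [h2] at h1
    have : (w a : ℕ) < w ⟨a + 1, h⟩ := hw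
    omega
  have h0 := hqk 0 hn
  refine lt_of_le_of_lt ?_ h0
  rw [ascents, ← Finset.card_range (q 0)]
  -- Sending each ascent to the value of `q` just after its drop is injective, with values below `q
  -- 0`.
  refine Finset.card_le_card_of_injOn (fun a => q (a + 1)) ?_ ?_
  · intro a ha
    obtain ⟨h1, h2⟩ := (Finset.mem_filter.1 ha).2
    exact Finset.mem_coe.2 (Finset.mem_range.2 ((hasc a h1 h2).trans_le
      (hqa 0 a (Nat.zero_le _) a.2)))
  · have key : ∀ a b : Fin n, (∃ h : (b : ℕ) + 1 < n, w b < w ⟨(b : ℕ) + 1, h⟩) → a < b →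
        q (b + 1) < q (a + 1) := fun a b ⟨h1, h2⟩ hab =>
      (hasc b h1 h2).trans_le (hqa _ _ hab b.2)
    intro a ha b hb hab
    have ha := (Finset.mem_filter.1 ha).2
    have hb := (Finset.mem_filter.1 hb).2
    rcases lt_trichotomy a b with h | h | h
    · exact absurd hab (key a b hb h).ne'
    · exact h
    · exact absurd hab (key b a ha h).ne

theorem hasTransversal_of_stabilizesAt {k : ℕ} (hn : 0 < n) (hk : 1 ≤ k)
    (h : (permTableau w).StabilizesAt (permTableau_isStandard w) (permTableau_antitone w) k) :
    (permCopies w k).HasTransversal n := by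
  obtain ⟨R, hR, hrow⟩ := h
  rw [permTableau_size] at hrow
  have hv := rowValue_bounds w (n - 1) (by omega)
  have hkn : k * n = (k - 1) * n + n := by
    rw [← Nat.succ_mul, Nat.succ_eq_add_one, Nat.sub_add_cancel hk]
  -- The last cell of the bottom row carries an entry of the `k`-th copy, to which stabilization
  -- applies; one such entry is all that the lower bound needs.
  have hin : (permCopies w k).InRow ((k - 1) * n + rowValue w (n - 1)) (n - 1) :=
    ⟨k - 1, by
      rw [permCopies_entry w (by omega) (by omega) (by omega), Nat.sub_self, Nat.sub_zero,
        add_comm]⟩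
  obtain ⟨j, hj⟩ := (hrow _ (Finset.mem_Icc.2 ⟨by omega, by omega⟩) (n - 1)).2 hin
  have hm : (n - 1, j) ∈ R.outer := by
    by_contra h
    have := R.zeros (i := n - 1) (j := j) fun h' => h h'.1
    omega
  have hT := hasTransversal_of_inner_eq_bot hR.2 hm
  rw [Nat.sub_add_cancel hn] at hT
  exact hasTransversal_of_slides hR.1 (fun i j h => ((mem_permCopies_outer w).1 h).1) hT

end Permutation

theorem mainTheorem11 (n : ℕ) (w : Equiv.Perm (Fin n)) : ascents w < permStab w := by
  -- Existence matters here: the infimum of an empty set of naturals would be `0`.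
  obtain ⟨hk, hs⟩ := Nat.sInf_mem (exists_stabilizesAt w)
  change 1 ≤ permStab w at hk
  rcases Nat.eq_zero_or_pos n with rfl | hn
  · exact lt_of_lt_of_le (by simp [ascents]) hk
  · exact ascents_lt_of_hasTransversal w hn (hasTransversal_of_stabilizesAt w hn hk hs)
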